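/- For $f:\mathbf R^2\to\mathbf C$ let $R[f](\xi,\eta)=\int_{\mathbf R} f(x,\xi x+\eta)\,dx$ be its Radon transform, and for $0<\alpha\le 1$ let $\|f\|_{C^{0,\alpha}(\mathbf R^2)}=\sup_{p\ne q}|f(p)-f(q)|/\|p-q\|^{\alpha}$ be the Hölder semi-norm. Let $\|\cdot\|_{\varepsilon,\gamma}$ ($\varepsilon,\gamma>0$) be any family of norms (more generally, of $[0,\infty]$-valued functionals) of the data such that, for some absolute constant $\kappa$, $$\max\Big\{\iint_{|\xi|\le\varepsilon,\ |\eta|<\gamma}|g(\xi,\eta)|\,d\xi\,d\eta,\ \int_{-\varepsilon}^{\varepsilon}|g(\xi,\gamma)|\,d\xi\Big\}\le\kappa\,\|g\|_{\varepsilon,\gamma}$$ for all $0<\varepsilon,\gamma<1$ and all continuous $g$; an example is $\|g\|_{\varepsilon,\gamma}=\sup_{|\eta|\le\gamma}\int_{-\varepsilon}^{\varepsilon}|g(\xi,\eta)|\,d\xi$. Let $0<\varepsilon<1$. Then there is $\delta_0\in(0,1)$ such that for every $\delta\in(0,\delta_0]$, every $\alpha\in(1/2,1]$, every $\rho$ with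 $0<\rho<\alpha-1/2$ and every $C_0\ge0$ there are constants $C>0$ and $h_0\in(0,1)$ with the following property. If $u:\mathbf R^2\to\mathbf C$ satisfies $\|u\|_{C^{0,\alpha}(\mathbf R^2)}\le C_0$ and $\operatorname{supp}u\subset\{(x,y):y\ge cx^2\}$ for some $c>1$, and if $\|R[u]\|_{\varepsilon,\delta}\le h_0$, then $$\sup_{x\in\mathbf R}|u(x,\delta)|\le\frac{C}{\log^{\rho}(1/\|R[u]\|_{\varepsilon,\delta})},$$ where for $\|R[u]\|_{\varepsilon,\delta}=0$ the right-hand side is read as $0$, i.e. $u(x,\delta)=0$ for all $x$. The constants $C,h_0$ do not depend on $u$ or $c$ (they may depend on $C_0,\alpha,\rho,\varepsilon,\delta$ and on the family of norms). -/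

import Mathlib

open MeasureTheory Set
open scoped ENNReal NNReal

noncomputable section

/-- The Radon transform in the plane, `R[f](ξ, η) = ∫ f(x, ξ x + η) dx`: the integral of `f` along
the line of slope `ξ` and intercept `η`. -/
def radon (f : EuclideanSpace ℝ (Fin 2) → ℂ) (ξ η : ℝ) : ℂ :=
  ∫ x : ℝ, f !₂[x, ξ * x + η]

/-- The rectangle `|ξ| ≤ ε`, `|η| < γ` in the space of lines. -/
def dataRect (ε γ : ℝ) : Set (ℝ × ℝ) := {p | |p.1| ≤ ε ∧ |p.2| < γ}

/-- The `L¹` norm of the data `g = g(ξ, η)` on the rectangle `|ξ| ≤ ε`, `|η| < γ`. -/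
def rectNorm (ε γ : ℝ) (g : ℝ → ℝ → ℂ) : ℝ≥0∞ :=
  ∫⁻ p in dataRect ε γ, ‖g p.1 p.2‖ₑ

/-- The `L¹[-ε, ε]` norm of `g(·, η)`. -/
def lineNorm (ε η : ℝ) (g : ℝ → ℝ → ℂ) : ℝ≥0∞ :=
  ∫⁻ ξ in Icc (-ε) ε, ‖g ξ η‖ₑ

/-- A family `N ε γ` of `[0, ∞]`-valued functionals of the data controls the data if
`max {‖g‖_{L¹(|ξ| ≤ ε, |η| < γ)}, ‖g(·, γ)‖_{L¹[-ε, ε]}} ≤ κ N ε γ g` for an absolute constant `κ`.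
This is all that is asked of a norm `‖g‖_{ε,γ}` of the data; the norm axioms and monotonicity in
`ε` and `γ` are not demanded, so every norm with this property is included. -/
def ControlsData (N : ℝ → ℝ → (ℝ → ℝ → ℂ) → ℝ≥0∞) : Prop :=
  ∃ κ : ℝ≥0, ∀ ε γ : ℝ, 0 < ε → ε < 1 → 0 < γ → γ < 1 →
    ∀ g : ℝ → ℝ → ℂ, Continuous (fun p : ℝ × ℝ => g p.1 p.2) →
      max (rectNorm ε γ g) (lineNorm ε γ g) ≤ κ * N ε γ g

/-- The basic example of a norm of the data, `sup_{|η| ≤ γ} ‖g(·, η)‖_{L¹[-ε, ε]}`. -/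
def supDataNorm (ε γ : ℝ) (g : ℝ → ℝ → ℂ) : ℝ≥0∞ :=
  ⨆ η ∈ Icc (-γ) γ, lineNorm ε η g

theorem controlsData_supDataNorm : ControlsData supDataNorm := by
  refine ⟨2, fun ε γ _ _ hγ hγ1 g hg => max_le ?_ ?_⟩
  · have hset : dataRect ε γ = Icc (-ε) ε ×ˢ Ioo (-γ) γ := by
      ext p
      simp [dataRect, abs_le, abs_lt]
    have hm : Measurable (fun p : ℝ × ℝ => ‖g p.1 p.2‖ₑ) := hg.enorm.measurable
    unfold rectNorm
    rw [hset, Measure.volume_eq_prod, ← Measure.prod_restrict,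
      lintegral_prod_symm' _ hm]
    calc ∫⁻ y in Ioo (-γ) γ, ∫⁻ x in Icc (-ε) ε, ‖g x y‖ₑ
        ≤ ∫⁻ _ in Ioo (-γ) γ, supDataNorm ε γ g := by
          refine setLIntegral_mono measurable_const fun y hy => ?_
          exact le_iSup₂ (f := fun η (_ : η ∈ Icc (-γ) γ) => lineNorm ε η g) y
            (Ioo_subset_Icc_self hy)
      _ = supDataNorm ε γ g * ENNReal.ofReal (γ - -γ) := by
          rw [setLIntegral_const, Real.volume_Ioo]
      _ ≤ supDataNorm ε γ g * 2 := by
          gcongr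
          calc ENNReal.ofReal (γ - -γ) ≤ ENNReal.ofReal 2 := ENNReal.ofReal_le_ofReal (by linarith)
            _ = 2 := by simp
      _ = _ := by rw [mul_comm]; rfl
  · calc lineNorm ε γ g ≤ supDataNorm ε γ g :=
          le_iSup₂ (f := fun η (_ : η ∈ Icc (-γ) γ) => lineNorm ε η g) γ ⟨by linarith, le_rfl⟩
      _ ≤ _ := le_mul_of_one_le_left (by positivity) (by norm_num)

end

/-! Fix a point `(x₀, δ)`, with `U x y` the value of `u` at `(x, y)`, and average `U` over the lines
through `(0, δ)` with slopes `|ξ| ≤ 1/q`, weighted by the bump `(1 - (qξ)²)ᵐ`. Since `x` is the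
`ξ`-derivative of `ξx + δ`, the factor `xᵏ` in the `k`-th moment in `x` of this average can be
integrated by parts in `ξ`: derivatives fall on the bump and `U` is replaced by its `k`-fold
primitive in `y`. The parabolic support makes the Radon transform of that primitive the `k`-fold
primitive in `η` of the data, so every moment is bounded by the data near slope `0`
(`norm_integral_polynomial_smul_moment_le`).

Moments up to order `2n` combine into the Landau kernel `(1 - (x - x₀)²)ⁿ` at the cost of a factor
`4ⁿ` (`norm_integral_landau_smul_le`). With `n = q²` both kernel widths are about `1/q`, so the
Hölder bound gives an error of order `q^(-α)` (`norm_landau_average_sub_le`), while the data are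
amplified by at most `q^(13q²)`. For data of size `exp (-L)`, a degree `q` near `L^(ρ/α)` balances
the two: `q² log q` is `o(L)` because `ρ/α < 1/2` (`eventually_exists_degree`). -/

/-! ### Polynomial bumps in the slope variable -/

open Polynomial in
/-- The polynomial bump `(1 - (b x)²)ᵐ`, vanishing to order `m` at `x = ±1/b`. -/
noncomputable def bumpPoly (b : ℝ) (m : ℕ) : Polynomial ℝ := (1 - C (b ^ 2) * X ^ 2) ^ m

open Polynomial in
theorem eval_bumpPoly (b : ℝ) (m : ℕ) (x : ℝ) :
    (bumpPoly b m).eval x = (1 - (b * x) ^ 2) ^ m := by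
  simp [bumpPoly, mul_pow]

open Polynomial in
theorem eval_iterate_derivative_bumpPoly_eq_zero {b x : ℝ} (hx : (b * x) ^ 2 = 1) {k m : ℕ}
    (hk : k < m) : (derivative^[k] (bumpPoly b m)).eval x = 0 := by
  obtain ⟨r, hr⟩ := pow_sub_dvd_iterate_derivative_pow (1 - C (b ^ 2) * X ^ 2 : ℝ[X]) m k
  rw [bumpPoly, hr]
  have : (1 - b ^ 2 * x ^ 2) = 0 := by rw [← mul_pow, hx]; ring
  simp [this, Nat.sub_ne_zero_of_lt hk]

-- Expand binomially: differentiating `X^(2j)` costs at most `(2m)ᵏ`, the powers of `b` not absorbed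
-- by `|bx| ≤ 1` give `bᵏ`, and the binomial coefficients sum to `2ᵐ`.
open Polynomial in
theorem abs_eval_iterate_derivative_bumpPoly_le {b x : ℝ} (hb : 0 ≤ b) (hx : |b * x| ≤ 1)
    (k m : ℕ) :
    |(derivative^[k] (bumpPoly b m)).eval x| ≤ 2 ^ m * (2 * m * b) ^ k := by
  have hexp : bumpPoly b m
      = ∑ j ∈ Finset.range (m + 1), ((m.choose j : ℝ) * (-b ^ 2) ^ j) • (X ^ (2 * j) : ℝ[X]) := by
    rw [bumpPoly, sub_eq_neg_add, add_pow]
    refine Finset.sum_congr rfl fun j _ => ?_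
    rw [smul_eq_C_mul]
    simp only [one_pow, mul_one, map_mul, map_pow, map_neg, map_natCast, pow_mul]
    rw [← neg_mul, mul_pow]
    ring
  have hterm : ∀ j ∈ Finset.range (m + 1),
      |(derivative^[k] (((m.choose j : ℝ) * (-b ^ 2) ^ j) • (X ^ (2 * j) : ℝ[X]))).eval x|
        ≤ m.choose j * (2 * m * b) ^ k := by
    intro j hj
    have hjm : j ≤ m := Nat.lt_succ_iff.1 (Finset.mem_range.1 hj)
    rw [iterate_derivative_smul, iterate_derivative_X_pow_eq_smul]
    simp only [eval_smul, smul_eq_mul, eval_pow, eval_X, abs_mul, abs_pow, abs_neg,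
      Nat.abs_cast, abs_of_nonneg hb, mul_assoc]
    refine mul_le_mul_of_nonneg_left ?_ (by positivity)
    rcases lt_or_ge (2 * j) k with h | h
    · rw [Nat.descFactorial_of_lt h]
      simp
      positivity
    · have h1 : ((2 * j).descFactorial k : ℝ) ≤ (2 * m) ^ k := by
        have : (2 * j).descFactorial k ≤ (2 * m) ^ k :=
          (Nat.descFactorial_le_pow _ _).trans (Nat.pow_le_pow_left (by omega) _)
        exact_mod_cast this
      have h2 : (b ^ 2) ^ j * |x| ^ (2 * j - k) = b ^ k * |b * x| ^ (2 * j - k) := by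
        rw [abs_mul, abs_of_nonneg hb, mul_pow, ← mul_assoc, ← pow_add, ← pow_mul]
        congr 2; omega
      calc (b ^ 2) ^ j * (((2 * j).descFactorial k : ℝ) * |x| ^ (2 * j - k))
          = ((2 * j).descFactorial k : ℝ) * (b ^ k * |b * x| ^ (2 * j - k)) := by
            rw [← h2]; ring
        _ ≤ (2 * m) ^ k * (b ^ k * 1) := by
            gcongr
            exact pow_le_one₀ (abs_nonneg _) hx
        _ = _ := by rw [mul_one, ← mul_pow]; ring
  rw [hexp, iterate_derivative_sum, eval_finsetSum]
  calc _ ≤ ∑ j ∈ Finset.range (m + 1), (m.choose j : ℝ) * (2 * m * b) ^ k :=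
        (Finset.abs_sum_le_sum_abs _ _).trans (Finset.sum_le_sum hterm)
    _ = _ := by
      rw [← Finset.sum_mul]
      congr 1
      exact_mod_cast Nat.sum_range_choose m

/-! ### Mass and second moment of the Landau kernel -/

/-- The mass `∫_{-1}^{1} (1 - t²)ⁿ dt` of the Landau kernel. -/
noncomputable def landauMass (n : ℕ) : ℝ := ∫ t in (-1 : ℝ)..1, (1 - t ^ 2) ^ n

theorem landauMass_succ (n : ℕ) :
    (2 * n + 3) * landauMass (n + 1) = (2 * n + 2) * landauMass n := by
  have hd : ∀ t : ℝ, HasDerivAt (fun t : ℝ => t * (1 - t ^ 2) ^ (n + 1))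
      ((2 * n + 3) * (1 - t ^ 2) ^ (n + 1) - (2 * n + 2) * (1 - t ^ 2) ^ n) t := by
    intro t
    have h1 : HasDerivAt (fun t : ℝ => 1 - t ^ 2) (-(2 * t)) t := by
      simpa using ((hasDerivAt_id t).pow 2).const_sub 1
    have h2 := (hasDerivAt_id t).mul (h1.pow (n + 1))
    refine h2.congr_deriv ?_
    simp
    ring
  have h := intervalIntegral.integral_eq_sub_of_hasDerivAt (a := -1) (b := 1)
    (fun t _ => hd t) (Continuous.intervalIntegrable (by fun_prop) _ _)
  rw [intervalIntegral.integral_sub (Continuous.intervalIntegrable (by fun_prop) _ _)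
    (Continuous.intervalIntegrable (by fun_prop) _ _), intervalIntegral.integral_const_mul,
    intervalIntegral.integral_const_mul] at h
  simp at h
  unfold landauMass
  linarith

/-- The ratio `(2n+2)/(2n+3)` of consecutive masses is at least `(n+1)/(n+2)`. This crude bound
suffices: a power of `q` is negligible against `q^(13q²)`. -/
theorem one_div_le_landauMass (n : ℕ) : 1 / ((n : ℝ) + 1) ≤ landauMass n := by
  induction n with
  | zero => simp [landauMass]
  | succ n ih =>
    have h := landauMass_succ n
    have h1 : landauMass (n + 1) = (2 * n + 2) * landauMass n / (2 * n + 3) := by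
      field_simp; linarith
    rw [h1]
    calc 1 / (((n + 1 : ℕ) : ℝ) + 1) ≤ (2 * n + 2) * (1 / ((n : ℝ) + 1)) / (2 * n + 3) := by
          rw [div_le_div_iff₀ (by positivity) (by positivity)]
          have : (2 * n + 2) * (1 / ((n : ℝ) + 1)) = 2 := by field_simp
          rw [this]; push_cast; nlinarith [(Nat.cast_nonneg n : (0 : ℝ) ≤ n)]
      _ ≤ _ := by gcongr

theorem landauMass_pos (n : ℕ) : 0 < landauMass n :=
  lt_of_lt_of_le (by positivity) (one_div_le_landauMass n)

theorem integral_sq_mul_landau (n : ℕ) :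
    ∫ t in (-1 : ℝ)..1, (1 - t ^ 2) ^ n * t ^ 2 = landauMass n / (2 * n + 3) := by
  have h : ∫ t in (-1 : ℝ)..1, (1 - t ^ 2) ^ n * t ^ 2 = landauMass n - landauMass (n + 1) := by
    unfold landauMass
    rw [← intervalIntegral.integral_sub (Continuous.intervalIntegrable (by fun_prop) _ _)
      (Continuous.intervalIntegrable (by fun_prop) _ _)]
    congr 1; ext t; ring
  rw [h]
  have := landauMass_succ n
  field_simp
  linarith

theorem integral_eval_bumpPoly {b : ℝ} (hb : 0 < b) (m : ℕ) :
    ∫ ξ in (-b⁻¹)..b⁻¹, (bumpPoly b m).eval ξ = b⁻¹ * landauMass m := by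
  simp_rw [eval_bumpPoly]
  rw [intervalIntegral.integral_comp_mul_left (fun t => (1 - t ^ 2) ^ m) hb.ne']
  simp [landauMass, hb.ne']

/-! ### Moments of slope averages in terms of primitives of the data -/

/-- Repeated integration by parts against a polynomial vanishing at the end points. -/
theorem pow_smul_integral_polynomial_smul (P : Polynomial ℝ) (a b x : ℝ) (F : ℕ → ℝ → ℂ)
    (hF : ∀ j t, HasDerivAt (F (j + 1)) (x • F j t) t) (hF0 : Continuous (F 0)) (k : ℕ)
    (ha : ∀ j < k, (Polynomial.derivative^[j] P).eval a = 0)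
    (hb : ∀ j < k, (Polynomial.derivative^[j] P).eval b = 0) :
    x ^ k • ∫ ξ in a..b, P.eval ξ • F 0 ξ
      = (-1 : ℝ) ^ k • ∫ ξ in a..b, (Polynomial.derivative^[k] P).eval ξ • F k ξ := by
  have hc : ∀ j, Continuous (F j) := by
    rintro (_ | j)
    · exact hF0
    · exact continuous_iff_continuousAt.2 fun t => (hF j t).continuousAt
  induction k with
  | zero => simp
  | succ k ih =>
    have ih := ih (fun j hj => ha j (hj.trans k.lt_succ_self))
      (fun j hj => hb j (hj.trans k.lt_succ_self))
    set Q := Polynomial.derivative^[k] P with hQ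
    have hQd : Polynomial.derivative^[k + 1] P = Polynomial.derivative Q := by
      rw [hQ, Function.iterate_succ_apply']
    have hparts := intervalIntegral.integral_smul_deriv_eq_deriv_smul (a := a) (b := b)
      (u := fun ξ => Q.eval ξ) (v := F (k + 1)) (u' := fun ξ => (Polynomial.derivative Q).eval ξ)
      (v' := fun ξ => x • F k ξ) (fun t _ => Q.hasDerivAt t) (fun t _ => hF k t)
      (Continuous.intervalIntegrable (by fun_prop) _ _)
      (Continuous.intervalIntegrable (by have := hc k; fun_prop) _ _)
    rw [pow_succ', mul_smul, ih, hQd, smul_comm, ← intervalIntegral.integral_smul]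
    have : ∀ ξ, x • Q.eval ξ • F k ξ = Q.eval ξ • x • F k ξ := fun ξ => smul_comm _ _ _
    simp_rw [this]
    rw [hparts, ha k k.lt_succ_self, hb k k.lt_succ_self]
    simp [pow_succ]

/-- The `j`-fold primitive of `g`, based at `-1`. -/
noncomputable def iterPrimitive (g : ℝ → ℂ) : ℕ → ℝ → ℂ
  | 0 => g
  | j + 1 => fun t => ∫ s in (-1 : ℝ)..t, iterPrimitive g j s

theorem continuous_iterPrimitive {U : ℝ → ℝ → ℂ} (hU : Continuous fun p : ℝ × ℝ => U p.1 p.2)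
    (j : ℕ) : Continuous fun p : ℝ × ℝ => iterPrimitive (U p.1) j p.2 := by
  induction j with
  | zero => exact hU
  | succ j ih =>
    refine intervalIntegral.continuous_parametric_intervalIntegral_of_continuous
      (f := fun (p : ℝ × ℝ) s => iterPrimitive (U p.1) j s) (s := fun p => p.2) ?_ continuous_snd
    exact ih.comp (by fun_prop : Continuous fun q : (ℝ × ℝ) × ℝ => (q.1.1, q.2))

theorem iterPrimitive_eq_zero {g : ℝ → ℂ} {r : ℝ} (hr : 0 ≤ r) (hg : ∀ t < r, g t = 0) (j : ℕ) :
    ∀ t < r, iterPrimitive g j t = 0 := by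
  induction j with
  | zero => exact hg
  | succ j ih =>
    intro t ht
    have : ∫ s in (-1 : ℝ)..t, iterPrimitive g j s = ∫ s in (-1 : ℝ)..t, (0 : ℂ) := by
      refine intervalIntegral.integral_congr fun s hs => ih s ?_
      exact hs.2.trans_lt (max_lt (by linarith) ht)
    simpa [iterPrimitive] using this

theorem intervalIntegral_swap_of_continuous {F : ℝ → ℝ → ℂ}
    (hF : Continuous fun p : ℝ × ℝ => F p.1 p.2) (a b c d : ℝ) :
    ∫ x in a..b, ∫ y in c..d, F x y = ∫ y in c..d, ∫ x in a..b, F x y := by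
  refine MeasureTheory.intervalIntegral_intervalIntegral_swap ?_
  have : IntegrableOn (Function.uncurry F) (uIcc a b ×ˢ uIcc c d) :=
    hF.continuousOn.integrableOn_compact (isCompact_uIcc.prod isCompact_uIcc)
  exact this.mono_set (prod_mono uIoc_subset_uIcc uIoc_subset_uIcc)

/-- The truncated Radon transform of the `j`-fold primitive of `U` in the second variable. -/
noncomputable def primRadon (U : ℝ → ℝ → ℂ) (a b : ℝ) (j : ℕ) (ξ η : ℝ) : ℂ :=
  ∫ x in a..b, iterPrimitive (U x) j (ξ * x + η)

theorem continuous_primRadon {U : ℝ → ℝ → ℂ} (hU : Continuous fun p : ℝ × ℝ => U p.1 p.2)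
    (a b : ℝ) (j : ℕ) : Continuous fun p : ℝ × ℝ => primRadon U a b j p.1 p.2 := by
  refine intervalIntegral.continuous_parametric_intervalIntegral_of_continuous'
    (f := fun (p : ℝ × ℝ) x => iterPrimitive (U x) j (p.1 * x + p.2)) ?_ a b
  exact (continuous_iterPrimitive hU j).comp
    (by fun_prop : Continuous fun q : (ℝ × ℝ) × ℝ => (q.2, q.1.1 * q.2 + q.1.2))

theorem primRadon_succ {U : ℝ → ℝ → ℂ} (hU : Continuous fun p : ℝ × ℝ => U p.1 p.2)
    (hU0 : ∀ x t, t < x ^ 2 → U x t = 0) (a b : ℝ) (j : ℕ) {ξ δ : ℝ} (hξ : ξ ^ 2 < 4 * δ) (η : ℝ) :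
    primRadon U a b (j + 1) ξ η = ∫ τ in (-δ)..η, primRadon U a b j ξ τ := by
  have hc := continuous_iterPrimitive hU j
  unfold primRadon
  rw [intervalIntegral_swap_of_continuous
    (F := fun τ x => iterPrimitive (U x) j (ξ * x + τ))
    (hc.comp (by fun_prop : Continuous fun q : ℝ × ℝ => (q.2, ξ * q.2 + q.1)))]
  congr 1
  ext x
  have hcx : Continuous (iterPrimitive (U x) j) :=
    hc.comp (by fun_prop : Continuous fun s : ℝ => (x, s))
  rw [intervalIntegral.integral_comp_add_left (iterPrimitive (U x) j),
    ← intervalIntegral.integral_interval_sub_left (hcx.intervalIntegrable (-1) _)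
      (hcx.intervalIntegrable (-1) _)]
  -- `ξ² < 4δ` is the discriminant condition for the line `y = ξx - δ` to lie strictly below the
  -- parabola `y = x²`, so the primitive in `η` may be based at `-δ`.
  have h0 : iterPrimitive (U x) (j + 1) (ξ * x + -δ) = 0 :=
    iterPrimitive_eq_zero (sq_nonneg x) (hU0 x) _ _ (by nlinarith [sq_nonneg (x - ξ / 2)])
  change _ = iterPrimitive (U x) (j + 1) _ - iterPrimitive (U x) (j + 1) _
  rw [h0, sub_zero]

theorem norm_primRadon_succ_le {U : ℝ → ℝ → ℂ} (hU : Continuous fun p : ℝ × ℝ => U p.1 p.2)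
    (hU0 : ∀ x t, t < x ^ 2 → U x t = 0) (a b : ℝ) {ξ δ : ℝ} (hξ : ξ ^ 2 < 4 * δ)
    (hδ0 : 0 < δ) (hδ : 2 * δ ≤ 1) (j : ℕ) :
    ∀ η ∈ Icc (-δ) δ,
      ‖primRadon U a b (j + 1) ξ η‖ ≤ ∫ τ in (-δ)..δ, ‖primRadon U a b 0 ξ τ‖ := by
  have hc : Continuous fun τ => primRadon U a b 0 ξ τ :=
    (continuous_primRadon hU a b 0).comp (by fun_prop : Continuous fun τ : ℝ => (ξ, τ))
  induction j with
  | zero =>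
    intro η hη
    rw [primRadon_succ hU hU0 a b 0 hξ]
    refine (intervalIntegral.norm_integral_le_integral_norm hη.1).trans ?_
    exact intervalIntegral.integral_mono_interval le_rfl hη.1 hη.2
      (Filter.Eventually.of_forall fun _ => norm_nonneg _) (hc.norm.intervalIntegrable _ _)
  | succ j ih =>
    intro η hη
    rw [primRadon_succ hU hU0 a b (j + 1) hξ]
    have h0 : 0 ≤ ∫ τ in (-δ)..δ, ‖primRadon U a b 0 ξ τ‖ :=
      intervalIntegral.integral_nonneg (by linarith) fun _ _ => norm_nonneg _
    refine (intervalIntegral.norm_integral_le_of_norm_le_const (fun τ hτ => ih τ ?_)).trans ?_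
    · rw [uIoc_of_le hη.1] at hτ
      exact ⟨hτ.1.le, hτ.2.trans hη.2⟩
    -- Each further primitive runs over an interval of length at most `2δ ≤ 1`, so the bound does
    -- not grow with `j`.
    · refine mul_le_of_le_one_right h0 ?_
      rw [abs_le]
      constructor <;> linarith [hη.1, hη.2]

/-- Integration by parts in `ξ` for each fixed `x`, then Fubini: the inner integral in `x` becomes
the truncated Radon transform of the `k`-fold primitive. -/
theorem integral_polynomial_smul_moment {U : ℝ → ℝ → ℂ}
    (hU : Continuous fun p : ℝ × ℝ => U p.1 p.2) (P : Polynomial ℝ) (a b s δ : ℝ) (k : ℕ)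
    (hP : ∀ j < k, (Polynomial.derivative^[j] P).eval (-s) = 0)
    (hP' : ∀ j < k, (Polynomial.derivative^[j] P).eval s = 0) :
    ∫ x in a..b, x ^ k • ∫ ξ in (-s)..s, P.eval ξ • U x (ξ * x + δ)
      = (-1 : ℝ) ^ k • ∫ ξ in (-s)..s,
          (Polynomial.derivative^[k] P).eval ξ • primRadon U a b k ξ δ := by
  have hc := continuous_iterPrimitive hU
  have h1 : ∀ x, x ^ k • ∫ ξ in (-s)..s, P.eval ξ • U x (ξ * x + δ)
      = (-1 : ℝ) ^ k • ∫ ξ in (-s)..s,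
          (Polynomial.derivative^[k] P).eval ξ • iterPrimitive (U x) k (ξ * x + δ) := by
    intro x
    have hcx : ∀ j, Continuous (iterPrimitive (U x) j) := fun j =>
      (hc j).comp (by fun_prop : Continuous fun s : ℝ => (x, s))
    refine pow_smul_integral_polynomial_smul P (-s) s x
      (fun j ξ => iterPrimitive (U x) j (ξ * x + δ)) (fun j t => ?_)
      ((hcx 0).comp (by fun_prop)) k hP hP'
    have hd : HasDerivAt (iterPrimitive (U x) (j + 1)) (iterPrimitive (U x) j (t * x + δ))
        (t * x + δ) :=
      intervalIntegral.integral_hasDerivAt_right ((hcx j).intervalIntegrable _ _)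
        ((hcx j).stronglyMeasurableAtFilter _ _) (hcx j).continuousAt
    have hl : HasDerivAt (fun t : ℝ => t * x + δ) x t := by
      simpa using ((hasDerivAt_id t).mul_const x).add_const δ
    exact hd.scomp t hl
  simp_rw [h1]
  rw [intervalIntegral.integral_smul, intervalIntegral_swap_of_continuous]
  · simp_rw [intervalIntegral.integral_smul]
    rfl
  · have := (hc k).comp
      (by fun_prop : Continuous fun q : ℝ × ℝ => (q.1, q.2 * q.1 + δ))
    fun_prop

theorem norm_integral_polynomial_smul_moment_le {U : ℝ → ℝ → ℂ}
    (hU : Continuous fun p : ℝ × ℝ => U p.1 p.2) (hU0 : ∀ x t, t < x ^ 2 → U x t = 0)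
    (P : Polynomial ℝ) {a b s δ B M : ℝ} (k : ℕ) (hs : 0 ≤ s) (hsδ : s ^ 2 < 4 * δ)
    (hδ : 2 * δ ≤ 1)
    (hP : ∀ j < k, (Polynomial.derivative^[j] P).eval (-s) = 0)
    (hP' : ∀ j < k, (Polynomial.derivative^[j] P).eval s = 0)
    (hB0 : 0 ≤ B) (hB : ∀ ξ ∈ Icc (-s) s, |(Polynomial.derivative^[k] P).eval ξ| ≤ B)
    (hM : ∫ ξ in (-s)..s, ‖primRadon U a b 0 ξ δ‖ ≤ M)
    (hM' : ∫ ξ in (-s)..s, ∫ τ in (-δ)..δ, ‖primRadon U a b 0 ξ τ‖ ≤ M) :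
    ‖∫ x in a..b, x ^ k • ∫ ξ in (-s)..s, P.eval ξ • U x (ξ * x + δ)‖ ≤ B * M := by
  have hδ0 : 0 < δ := by nlinarith [sq_nonneg s]
  have hcW := fun j => continuous_primRadon hU a b j
  have hcδ : ∀ j, Continuous fun ξ => primRadon U a b j ξ δ := fun j =>
    (hcW j).comp (by fun_prop : Continuous fun ξ : ℝ => (ξ, δ))
  have hcD : Continuous fun ξ => ∫ τ in (-δ)..δ, ‖primRadon U a b 0 ξ τ‖ :=
    intervalIntegral.continuous_parametric_intervalIntegral_of_continuous'
      (f := fun ξ τ => ‖primRadon U a b 0 ξ τ‖) (hcW 0).norm _ _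
  rw [integral_polynomial_smul_moment hU P a b s δ k hP hP', norm_smul]
  simp only [norm_pow, norm_neg, norm_one, one_pow, one_mul]
  have hle : -s ≤ s := by linarith
  have key : ∀ D : ℝ → ℝ, Continuous D → (∀ ξ ∈ Icc (-s) s, ‖primRadon U a b k ξ δ‖ ≤ D ξ) →
      ∫ ξ in (-s)..s, D ξ ≤ M →
      ‖∫ ξ in (-s)..s, (Polynomial.derivative^[k] P).eval ξ • primRadon U a b k ξ δ‖ ≤ B * M := by
    intro D hD hle' hDM
    calc _ ≤ ∫ ξ in (-s)..s, ‖(Polynomial.derivative^[k] P).eval ξ • primRadon U a b k ξ δ‖ :=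
          intervalIntegral.norm_integral_le_integral_norm hle
      _ ≤ ∫ ξ in (-s)..s, B * D ξ := by
          refine intervalIntegral.integral_mono_on hle
            (Continuous.intervalIntegrable (by have := hcδ k; fun_prop) _ _)
            ((hD.const_mul B).intervalIntegrable _ _) fun ξ hξ => ?_
          rw [norm_smul, Real.norm_eq_abs]
          exact mul_le_mul (hB ξ hξ) (hle' ξ hξ) (norm_nonneg _) hB0
      _ = B * ∫ ξ in (-s)..s, D ξ := intervalIntegral.integral_const_mul _ _
      _ ≤ B * M := by gcongr
  -- The zeroth moment sees the data on the line `η = δ`, and all higher ones see their integral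
  -- over `|η| ≤ δ`; hence both quantities must be controlled.
  rcases k with _ | k
  · exact key _ (hcδ 0).norm (fun _ _ => le_rfl) hM
  · refine key _ hcD (fun ξ hξ => ?_) hM'
    refine norm_primRadon_succ_le hU hU0 a b (lt_of_le_of_lt ?_ hsδ) hδ0 hδ k δ
      ⟨by linarith, le_rfl⟩
    exact sq_le_sq' hξ.1 hξ.2

/-! ### Landau averages: bound by moments and approximation error -/

theorem norm_integral_weight_smul_sub_le {a b : ℝ} (hab : a ≤ b) {w e : ℝ → ℝ} {f : ℝ → ℂ}
    (hw : Continuous w) (he : Continuous e) (hf : Continuous f) (c : ℂ)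
    (hw0 : ∀ x ∈ Icc a b, 0 ≤ w x) (hfe : ∀ x ∈ Icc a b, ‖f x - c‖ ≤ e x) :
    ‖(∫ x in a..b, w x • f x) - (∫ x in a..b, w x) • c‖ ≤ ∫ x in a..b, w x * e x := by
  have h : (∫ x in a..b, w x • f x) - (∫ x in a..b, w x) • c = ∫ x in a..b, w x • (f x - c) := by
    simp_rw [smul_sub]
    rw [intervalIntegral.integral_sub (Continuous.intervalIntegrable (by fun_prop) _ _)
      (Continuous.intervalIntegrable (by fun_prop) _ _), intervalIntegral.integral_smul_const]
  rw [h]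
  refine (intervalIntegral.norm_integral_le_integral_norm hab).trans ?_
  refine intervalIntegral.integral_mono_on hab (Continuous.intervalIntegrable (by fun_prop) _ _)
    (Continuous.intervalIntegrable (by fun_prop) _ _) fun x hx => ?_
  rw [norm_smul, Real.norm_of_nonneg (hw0 x hx)]
  exact mul_le_mul_of_nonneg_left (hfe x hx) (hw0 x hx)

/-- Factor `1 - (x - x₀)² = (1 + x₀ - x)(1 - x₀ + x)`. As `|x₀| ≤ 1`, the absolute values of the
coefficients in the double binomial expansion sum to `((2 + x₀)(2 - x₀))ⁿ = (4 - x₀²)ⁿ`. -/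
theorem norm_integral_landau_smul_le {f : ℝ → ℂ} (hf : Continuous f) {a b x₀ B : ℝ}
    (hx₀ : |x₀| ≤ 1) (n : ℕ) (hB : ∀ k ≤ 2 * n, ‖∫ x in a..b, x ^ k • f x‖ ≤ B) :
    ‖∫ x in a..b, (1 - (x - x₀) ^ 2) ^ n • f x‖ ≤ 4 ^ n * B := by
  obtain ⟨h1, h2⟩ := abs_le.1 hx₀
  have hB0 : 0 ≤ B := (norm_nonneg _).trans (hB 0 (Nat.zero_le _))
  let c : ℕ → ℕ → ℝ := fun i j =>
    ((1 + x₀) ^ (n - i) * n.choose i) * ((1 - x₀) ^ (n - j) * n.choose j)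
  have hc : ∀ i j, 0 ≤ c i j := fun i j =>
    mul_nonneg (mul_nonneg (pow_nonneg (by linarith) _) (Nat.cast_nonneg _))
      (mul_nonneg (pow_nonneg (by linarith) _) (Nat.cast_nonneg _))
  have hexp : ∀ x, (1 - (x - x₀) ^ 2) ^ n • f x
      = ∑ i ∈ Finset.range (n + 1), ∑ j ∈ Finset.range (n + 1),
          ((-1) ^ i * c i j) • (x ^ (i + j) • f x) := by
    intro x
    have : (1 - (x - x₀) ^ 2) ^ n
        = ∑ i ∈ Finset.range (n + 1), ∑ j ∈ Finset.range (n + 1),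
          ((-1) ^ i * c i j) * x ^ (i + j) := by
      rw [show 1 - (x - x₀) ^ 2 = (-x + (1 + x₀)) * (x + (1 - x₀)) by ring, mul_pow, add_pow,
        add_pow x, Finset.sum_mul_sum]
      refine Finset.sum_congr rfl fun i _ => Finset.sum_congr rfl fun j _ => ?_
      rw [neg_pow x]
      simp only [c]
      ring
    rw [this, Finset.sum_smul]
    refine Finset.sum_congr rfl fun i _ => ?_
    rw [Finset.sum_smul]
    exact Finset.sum_congr rfl fun j _ => mul_smul _ _ _
  have hint : ∫ x in a..b, (1 - (x - x₀) ^ 2) ^ n • f x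
      = ∑ i ∈ Finset.range (n + 1), ∑ j ∈ Finset.range (n + 1),
          ((-1) ^ i * c i j) • ∫ x in a..b, x ^ (i + j) • f x := by
    simp_rw [hexp]
    rw [intervalIntegral.integral_finsetSum
      fun i _ => Continuous.intervalIntegrable (by fun_prop) _ _]
    refine Finset.sum_congr rfl fun i _ => ?_
    rw [intervalIntegral.integral_finsetSum
      fun i _ => Continuous.intervalIntegrable (by fun_prop) _ _]
    exact Finset.sum_congr rfl fun j _ => intervalIntegral.integral_smul _ _
  have hsum : ∑ i ∈ Finset.range (n + 1), ∑ j ∈ Finset.range (n + 1), c i j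
      = ((2 + x₀) * (2 - x₀)) ^ n := by
    rw [mul_pow, show 2 + x₀ = 1 + (1 + x₀) by ring, show 2 - x₀ = 1 + (1 - x₀) by ring, add_pow,
      add_pow 1 (1 - x₀), Finset.sum_mul_sum]
    simp [c]
  calc ‖∫ x in a..b, (1 - (x - x₀) ^ 2) ^ n • f x‖
      ≤ ∑ i ∈ Finset.range (n + 1), ∑ j ∈ Finset.range (n + 1), c i j * B := by
        rw [hint]
        refine norm_sum_le_of_le _ fun i hi => norm_sum_le_of_le _ fun j hj => ?_
        rw [norm_smul, norm_mul, norm_pow, norm_neg, norm_one, one_pow, one_mul,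
          Real.norm_of_nonneg (hc i j)]
        have hi' := Finset.mem_range.1 hi
        have hj' := Finset.mem_range.1 hj
        exact mul_le_mul_of_nonneg_left (hB _ (by omega)) (hc i j)
    _ = ((2 + x₀) * (2 - x₀)) ^ n * B := by
        simp_rw [← Finset.sum_mul]
        rw [hsum]
    _ ≤ 4 ^ n * B := by
        gcongr
        · exact mul_nonneg (by linarith) (by linarith)
        · nlinarith [sq_nonneg x₀]

theorem rpow_le_one_add_sq {z α : ℝ} (hz : 0 ≤ z) (hα0 : 0 ≤ α) (hα : α ≤ 2) :
    z ^ α ≤ 1 + z ^ 2 := by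
  rcases le_total z 1 with h | h
  · exact (Real.rpow_le_one hz h hα0).trans (by nlinarith [sq_nonneg z])
  · calc z ^ α ≤ z ^ (2 : ℝ) := Real.rpow_le_rpow_of_exponent_le h hα
      _ ≤ _ := by rw [Real.rpow_two]; linarith

/-- Replaces the Hölder power by a quadratic at scale `1/b`, so that only the second moment of the
Landau kernel is needed. -/
theorem rpow_le_rpow_neg_mul {r b α : ℝ} (hr : 0 ≤ r) (hb : 0 < b) (hα0 : 0 ≤ α) (hα : α ≤ 2) :
    r ^ α ≤ b ^ (-α) * (1 + (b * r) ^ 2) := by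
  have h := rpow_le_one_add_sq (mul_nonneg hb.le hr) hα0 hα
  rw [Real.mul_rpow hb.le hr] at h
  calc r ^ α = b ^ (-α) * (b ^ α * r ^ α) := by
        rw [← mul_assoc, ← Real.rpow_add hb]; simp
    _ ≤ _ := by gcongr

/-- The averages of `U` along the lines through `(0, δ)` against the Landau kernel centred at `x₀`
approximate `U x₀ δ`. -/
theorem norm_landau_average_sub_le {U : ℝ → ℝ → ℂ} (hU : Continuous fun p : ℝ × ℝ => U p.1 p.2)
    {C₀ α : ℝ} (hC₀ : 0 ≤ C₀) (hα0 : 0 ≤ α) (hα : α ≤ 2)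
    (hH : ∀ x y x' y', ‖U x y - U x' y'‖ ≤ C₀ * √((x - x') ^ 2 + (y - y') ^ 2) ^ α)
    {x₀ δ b : ℝ} (hx₀ : |x₀| ≤ 1 / 4) (hb : 0 < b) (n m : ℕ) (hn : b ^ 2 ≤ n) :
    ‖(∫ x in (x₀ - 1)..(x₀ + 1), (1 - (x - x₀) ^ 2) ^ n •
        ∫ ξ in (-b⁻¹)..b⁻¹, (bumpPoly b m).eval ξ • U x (ξ * x + δ))
      - (landauMass n * (b⁻¹ * landauMass m)) • U x₀ δ‖
      ≤ landauMass n * (b⁻¹ * landauMass m) * (4 * C₀ * b ^ (-α)) := by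
  obtain ⟨hx1, hx2⟩ := abs_le.1 hx₀
  have hbi : 0 < b⁻¹ := inv_pos.2 hb
  set S := b⁻¹ * landauMass m with hS
  have hS0 : 0 < S := mul_pos hbi (landauMass_pos m)
  -- The constant is `3 = 1 + 2`, the `2` bounding the vertical term `(bξ)² x²`, since `|bξ| ≤ 1`
  -- and `|x| ≤ 5/4`.
  let e : ℝ → ℝ := fun x => C₀ * (b ^ (-α) * (3 + b ^ 2 * (x - x₀) ^ 2))
  have hpt : ∀ x ∈ Icc (x₀ - 1) (x₀ + 1), ∀ ξ ∈ Icc (-b⁻¹) b⁻¹,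
      ‖U x (ξ * x + δ) - U x₀ δ‖ ≤ e x := by
    intro x hx ξ hξ
    refine (hH _ _ _ _).trans (mul_le_mul_of_nonneg_left ?_ hC₀)
    refine (rpow_le_rpow_neg_mul (Real.sqrt_nonneg _) hb hα0 hα).trans ?_
    refine mul_le_mul_of_nonneg_left ?_ (by positivity)
    rw [mul_pow, Real.sq_sqrt (by positivity)]
    have h1 : (b * ξ) ^ 2 ≤ 1 := by
      rw [sq_le_one_iff_abs_le_one, abs_le]
      constructor
      · have := mul_le_mul_of_nonneg_left hξ.1 hb.le
        rwa [mul_neg, mul_inv_cancel₀ hb.ne'] at this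
      · have := mul_le_mul_of_nonneg_left hξ.2 hb.le
        rwa [mul_inv_cancel₀ hb.ne'] at this
    have h2 : x ^ 2 ≤ 2 := by nlinarith [hx.1, hx.2]
    have h3 : (b * ξ) ^ 2 * x ^ 2 ≤ 1 * 2 :=
      mul_le_mul h1 h2 (sq_nonneg _) zero_le_one
    nlinarith
  have hmass : ∫ ξ in (-b⁻¹)..b⁻¹, (bumpPoly b m).eval ξ = S := integral_eval_bumpPoly hb m
  have hbump0 : ∀ ξ ∈ Icc (-b⁻¹) b⁻¹, 0 ≤ (bumpPoly b m).eval ξ := by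
    intro ξ hξ
    rw [eval_bumpPoly]
    refine pow_nonneg ?_ _
    rw [sub_nonneg, sq_le_one_iff_abs_le_one, abs_le]
    constructor
    · have := mul_le_mul_of_nonneg_left hξ.1 hb.le
      rwa [mul_neg, mul_inv_cancel₀ hb.ne'] at this
    · have := mul_le_mul_of_nonneg_left hξ.2 hb.le
      rwa [mul_inv_cancel₀ hb.ne'] at this
  have hinner : ∀ x ∈ Icc (x₀ - 1) (x₀ + 1),
      ‖(∫ ξ in (-b⁻¹)..b⁻¹, (bumpPoly b m).eval ξ • U x (ξ * x + δ)) - S • U x₀ δ‖ ≤ S * e x := by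
    intro x hx
    have := norm_integral_weight_smul_sub_le (a := -b⁻¹) (b := b⁻¹) (by linarith)
      (w := fun ξ => (bumpPoly b m).eval ξ) (e := fun _ => e x)
      (f := fun ξ => U x (ξ * x + δ)) (by fun_prop) continuous_const
      (hU.comp (by fun_prop : Continuous fun ξ : ℝ => (x, ξ * x + δ))) (U x₀ δ) hbump0
      (hpt x hx)
    rwa [intervalIntegral.integral_mul_const, hmass] at this
  have hcont : Continuous fun x => ∫ ξ in (-b⁻¹)..b⁻¹, (bumpPoly b m).eval ξ • U x (ξ * x + δ) := by
    refine intervalIntegral.continuous_parametric_intervalIntegral_of_continuous'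
      (f := fun x ξ => (bumpPoly b m).eval ξ • U x (ξ * x + δ)) ?_ _ _
    have := hU.comp (by fun_prop : Continuous fun p : ℝ × ℝ => (p.1, p.2 * p.1 + δ))
    exact ((bumpPoly b m).continuous.comp continuous_snd).smul this
  have hJ : ∫ x in (x₀ - 1)..(x₀ + 1), (1 - (x - x₀) ^ 2) ^ n = landauMass n := by
    rw [intervalIntegral.integral_comp_sub_right (fun t => (1 - t ^ 2) ^ n)]
    simp [landauMass]
  have hJ2 : ∫ x in (x₀ - 1)..(x₀ + 1), (1 - (x - x₀) ^ 2) ^ n * (x - x₀) ^ 2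
      = landauMass n / (2 * n + 3) := by
    rw [intervalIntegral.integral_comp_sub_right (fun t => (1 - t ^ 2) ^ n * t ^ 2),
      ← integral_sq_mul_landau]
    simp
  have houter := norm_integral_weight_smul_sub_le (a := x₀ - 1) (b := x₀ + 1) (by linarith)
    (w := fun x => (1 - (x - x₀) ^ 2) ^ n) (e := fun x => S * e x) (by fun_prop)
    (by simp only [e]; fun_prop) hcont (S • U x₀ δ)
    (fun x hx => pow_nonneg (by nlinarith [hx.1, hx.2]) _) hinner
  rw [hJ, smul_smul] at houter
  refine houter.trans ?_
  have hcalc : ∫ x in (x₀ - 1)..(x₀ + 1), (1 - (x - x₀) ^ 2) ^ n * (S * e x)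
      = S * C₀ * b ^ (-α) * (3 * landauMass n + b ^ 2 * (landauMass n / (2 * n + 3))) := by
    rw [← hJ2, ← hJ, ← intervalIntegral.integral_const_mul, ← intervalIntegral.integral_const_mul,
      ← intervalIntegral.integral_add (Continuous.intervalIntegrable (by fun_prop) _ _)
        (Continuous.intervalIntegrable (by fun_prop) _ _), ← intervalIntegral.integral_const_mul]
    congr 1; ext x; simp only [e]; ring
  rw [hcalc]
  have hfin : b ^ 2 * (landauMass n / (2 * n + 3)) ≤ landauMass n := by
    rw [mul_div_assoc', div_le_iff₀ (by positivity)]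
    nlinarith [landauMass_pos n]
  calc _ ≤ S * C₀ * b ^ (-α) * (3 * landauMass n + landauMass n) := by gcongr
    _ = _ := by ring

/-! ### Explicit pointwise bound and choice of the degree -/

/-- Pointwise bound by the data: the approximation error of the Landau kernel of degree `2 q ^ 2`
plus the data norm times an explicit amplification factor. -/
theorem norm_le_of_primRadon_le {U : ℝ → ℝ → ℂ} (hU : Continuous fun p : ℝ × ℝ => U p.1 p.2)
    (hU0 : ∀ x t, t < x ^ 2 → U x t = 0) {C₀ α : ℝ} (hC₀ : 0 ≤ C₀) (hα0 : 0 ≤ α) (hα : α ≤ 2)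
    (hH : ∀ x y x' y', ‖U x y - U x' y'‖ ≤ C₀ * √((x - x') ^ 2 + (y - y') ^ 2) ^ α)
    {x₀ δ M : ℝ} (hx₀ : |x₀| ≤ 1 / 4) (hδ : 2 * δ ≤ 1) {q : ℕ} (hq : 4 ≤ q)
    (hqδ : ((q : ℝ)⁻¹) ^ 2 < 4 * δ)
    (hM : ∫ ξ in (-(q : ℝ)⁻¹)..(q : ℝ)⁻¹, ‖primRadon U (x₀ - 1) (x₀ + 1) 0 ξ δ‖ ≤ M)
    (hM' : ∫ ξ in (-(q : ℝ)⁻¹)..(q : ℝ)⁻¹,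
      ∫ τ in (-δ)..δ, ‖primRadon U (x₀ - 1) (x₀ + 1) 0 ξ τ‖ ≤ M) :
    ‖U x₀ δ‖ ≤ 4 * C₀ * (q : ℝ) ^ (-α) + (q : ℝ) ^ (13 * q ^ 2) * M := by
  have hq4 : (4 : ℝ) ≤ q := by exact_mod_cast hq
  have hb : (0 : ℝ) < q := by linarith
  have hbi : (0 : ℝ) < (q : ℝ)⁻¹ := inv_pos.2 hb
  set n := q ^ 2 with hn
  have hnq : (n : ℝ) = (q : ℝ) ^ 2 := by simp [hn]
  -- Moments up to order `2n` are used, so this order of vanishing kills all boundary terms.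
  set m := 2 * n + 1 with hm
  have hM0 : 0 ≤ M := le_trans
    (intervalIntegral.integral_nonneg (by linarith) fun _ _ => norm_nonneg _) hM
  set A := ∫ x in (x₀ - 1)..(x₀ + 1), (1 - (x - x₀) ^ 2) ^ n •
        ∫ ξ in (-(q : ℝ)⁻¹)..(q : ℝ)⁻¹, (bumpPoly q m).eval ξ • U x (ξ * x + δ) with hA
  have happ := norm_landau_average_sub_le (δ := δ) hU hC₀ hα0 hα hH hx₀ hb n m hnq.ge
  rw [← hA] at happ
  set S := landauMass n * ((q : ℝ)⁻¹ * landauMass m) with hS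
  have hS0 : 0 < S := mul_pos (landauMass_pos n) (mul_pos hbi (landauMass_pos m))
  have h1 : ((q : ℝ) * (q : ℝ)⁻¹) ^ 2 = 1 := by rw [mul_inv_cancel₀ hb.ne', one_pow]
  have h1' : ((q : ℝ) * -(q : ℝ)⁻¹) ^ 2 = 1 := by rw [mul_neg, neg_sq, h1]
  have hcont : Continuous fun x =>
      ∫ ξ in (-(q : ℝ)⁻¹)..(q : ℝ)⁻¹, (bumpPoly q m).eval ξ • U x (ξ * x + δ) := by
    refine intervalIntegral.continuous_parametric_intervalIntegral_of_continuous'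
      (f := fun x ξ => (bumpPoly q m).eval ξ • U x (ξ * x + δ)) ?_ _ _
    have := hU.comp (by fun_prop : Continuous fun p : ℝ × ℝ => (p.1, p.2 * p.1 + δ))
    exact ((bumpPoly q m).continuous.comp continuous_snd).smul this
  have hbase : (1 : ℝ) ≤ 2 * m * q := by
    have : (1 : ℝ) ≤ m := by rw [hm]; push_cast; nlinarith
    nlinarith
  have hAle : ‖A‖ ≤ 4 ^ n * (2 ^ m * (2 * m * q) ^ (2 * n) * M) := by
    refine norm_integral_landau_smul_le hcont (by linarith) n fun k hk => ?_
    have hkm : ∀ j < k, j < m := fun j hj => by omega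
    refine norm_integral_polynomial_smul_moment_le hU hU0 (bumpPoly q m) k hbi.le hqδ hδ
      (fun j hj => eval_iterate_derivative_bumpPoly_eq_zero h1' (hkm j hj))
      (fun j hj => eval_iterate_derivative_bumpPoly_eq_zero h1 (hkm j hj)) (by positivity)
      (fun ξ hξ => ?_) hM hM'
    refine (abs_eval_iterate_derivative_bumpPoly_le hb.le ?_ k m).trans ?_
    · rw [abs_mul, abs_of_pos hb, ← mul_inv_cancel₀ hb.ne']
      exact mul_le_mul_of_nonneg_left (abs_le.2 ⟨hξ.1, hξ.2⟩) hb.le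
    · gcongr
  have hSU : S * ‖U x₀ δ‖ ≤ S * (4 * C₀ * (q : ℝ) ^ (-α))
      + 4 ^ n * (2 ^ m * (2 * m * q) ^ (2 * n) * M) := by
    have : ‖S • U x₀ δ‖ = S * ‖U x₀ δ‖ := by rw [norm_smul, Real.norm_of_nonneg hS0.le]
    rw [← this]
    calc ‖S • U x₀ δ‖ = ‖A - (A - S • U x₀ δ)‖ := by rw [sub_sub_cancel]
      _ ≤ ‖A‖ + ‖A - S • U x₀ δ‖ := norm_sub_le _ _
      _ ≤ _ := by linarith
  have hS1 : 1 ≤ S * (q : ℝ) ^ 8 := by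
    have e1 : 1 ≤ landauMass n * (q : ℝ) ^ 3 := by
      have := one_div_le_landauMass n
      calc (1 : ℝ) = 1 / ((n : ℝ) + 1) * (n + 1) := by field_simp
        _ ≤ landauMass n * (q : ℝ) ^ 3 :=
          mul_le_mul this (by rw [hnq]; nlinarith) (by positivity) (landauMass_pos n).le
    have e2 : 1 ≤ landauMass m * (q : ℝ) ^ 4 := by
      have := one_div_le_landauMass m
      calc (1 : ℝ) = 1 / ((m : ℝ) + 1) * (m + 1) := by field_simp
        _ ≤ landauMass m * (q : ℝ) ^ 4 := by
          refine mul_le_mul this ?_ (by positivity) (landauMass_pos m).le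
          rw [hm]; push_cast; rw [hnq]; nlinarith [sq_nonneg ((q : ℝ) ^ 2)]
    calc (1 : ℝ) ≤ (landauMass n * (q : ℝ) ^ 3) * (landauMass m * (q : ℝ) ^ 4) :=
          one_le_mul_of_one_le_of_one_le e1 e2
      _ = S * (q : ℝ) ^ 8 := by rw [hS]; field_simp
  -- The factors contribute exponents `n`, `n + 1`, `10n` and `8`; the total `12n + 9` is at most
  -- `13n` because `n ≥ 16`.
  have hnum : 4 ^ n * (2 ^ m * (2 * m * q) ^ (2 * n)) * (q : ℝ) ^ 8 ≤ (q : ℝ) ^ (13 * n) := by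
    have e1 : (2 : ℝ) ^ m ≤ (q : ℝ) ^ (n + 1) := by
      calc (2 : ℝ) ^ m = 2 * (4 : ℝ) ^ n := by
            rw [hm, pow_succ, pow_mul]; norm_num; ring
        _ ≤ q * (q : ℝ) ^ n := by gcongr; linarith
        _ = _ := by ring
    have e2 : (2 * m * q : ℝ) ≤ (q : ℝ) ^ 5 := by
      have : (2 * m : ℝ) ≤ (q : ℝ) ^ 4 := by
        rw [hm]; push_cast; rw [hnq]; nlinarith [sq_nonneg ((q : ℝ) ^ 2)]
      calc (2 * m * q : ℝ) ≤ (q : ℝ) ^ 4 * q := by gcongr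
        _ = _ := by ring
    have hn16 : 16 ≤ n := by rw [hn]; nlinarith
    calc 4 ^ n * (2 ^ m * (2 * m * q) ^ (2 * n)) * (q : ℝ) ^ 8
        ≤ (q : ℝ) ^ n * ((q : ℝ) ^ (n + 1) * ((q : ℝ) ^ 5) ^ (2 * n)) * (q : ℝ) ^ 8 := by gcongr
      _ = (q : ℝ) ^ (12 * n + 9) := by rw [← pow_mul]; ring
      _ ≤ (q : ℝ) ^ (13 * n) := pow_le_pow_right₀ (by linarith) (by omega)
  refine le_of_mul_le_mul_left (hSU.trans ?_) hS0
  rw [mul_add]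
  refine add_le_add le_rfl ?_
  calc 4 ^ n * (2 ^ m * (2 * m * q) ^ (2 * n) * M)
      ≤ (4 ^ n * (2 ^ m * (2 * m * q) ^ (2 * n) * M)) * (S * (q : ℝ) ^ 8) :=
        le_mul_of_one_le_right (by positivity) hS1
    _ = S * ((4 ^ n * (2 ^ m * (2 * m * q) ^ (2 * n)) * (q : ℝ) ^ 8) * M) := by ring
    _ ≤ _ := by gcongr

open Filter Topology in
/-- A degree `q` of size `L ^ (ρ / α)` balances the approximation error against the
amplification of data of size `exp (-L)`. -/
theorem eventually_exists_degree {α ρ : ℝ} (hα : α ≤ 1) (hρ : 0 < ρ) (hρα : ρ < α - 1 / 2)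
    (q₀ : ℕ) : ∀ᶠ L : ℝ in atTop, ∃ q : ℕ, q₀ ≤ q ∧ (q : ℝ) ^ (-α) ≤ L ^ (-ρ) ∧
      (q : ℝ) ^ (13 * q ^ 2) * Real.exp (-L) ≤ L ^ (-ρ) := by
  have hα0 : 0 < α := by linarith
  set θ := ρ / α with hθ
  have hθ0 : 0 < θ := div_pos hρ hα0
  -- For `α ≤ 1`, `α - 1/2 ≤ α/2`.
  have hθ1 : θ < 1 / 2 := by rw [hθ, div_lt_iff₀ hα0]; linarith
  -- With `log q ≤ qᵉ/e`, the exponent `q² log q` is of order `L^(θ(2+e))`; this `e` makes `θ(2+e) =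
  -- θ + 1/2 < 1`.
  set e := 1 / (2 * θ) - 1 with he
  have he0 : 0 < e := by
    rw [he, sub_pos, lt_div_iff₀ (by positivity)]; linarith
  set β := θ + 1 / 2 with hβ
  have hθe : θ * (2 + e) = β := by rw [he, hβ]; field_simp; ring
  set K := 13 / e * 2 ^ (2 + e) with hK
  have hK0 : 0 < K := by positivity
  have ev1 : ∀ᶠ L : ℝ in atTop, (q₀ : ℝ) ≤ L ^ θ :=
    (tendsto_rpow_atTop hθ0).eventually_ge_atTop _
  -- Makes `K L^β ≤ L/2`, so the amplification uses up only half of the decay `exp (-L)`.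
  have ev2 : ∀ᶠ L : ℝ in atTop, L ^ (-(1 - β)) ≤ 1 / (2 * K) :=
    (tendsto_rpow_neg_atTop (by linarith : 0 < 1 - β)).eventually_le_const (by positivity)
  have ev3 : ∀ᶠ L : ℝ in atTop, Real.exp (-(1 / 2) * L) ≤ L ^ (-ρ) := by
    have h := (isLittleO_exp_neg_mul_rpow_atTop (by norm_num : (0 : ℝ) < 1 / 2) (-ρ)).bound
      zero_lt_one
    filter_upwards [h, eventually_ge_atTop 0] with L hL hL0
    rwa [one_mul, Real.norm_of_nonneg (Real.exp_nonneg _),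
      Real.norm_of_nonneg (Real.rpow_nonneg hL0 _)] at hL
  filter_upwards [ev1, ev2, ev3, eventually_ge_atTop 1] with L h1 h2 h3 hL
  have hL0 : 0 < L := by linarith
  have hLθ : 1 ≤ L ^ θ := Real.one_le_rpow hL hθ0.le
  have hle : L ^ θ ≤ (⌈L ^ θ⌉₊ : ℝ) := Nat.le_ceil _
  have hlt : (⌈L ^ θ⌉₊ : ℝ) ≤ 2 * L ^ θ := by
    have := Nat.ceil_lt_add_one (zero_le_one.trans hLθ)
    linarith
  generalize ⌈L ^ θ⌉₊ = q at hle hlt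
  have hq1 : (1 : ℝ) ≤ q := hLθ.trans hle
  have hq0 : (0 : ℝ) < q := by linarith
  refine ⟨q, by exact_mod_cast h1.trans hle, ?_, ?_⟩
  · calc (q : ℝ) ^ (-α) ≤ (L ^ θ) ^ (-α) :=
          Real.rpow_le_rpow_of_nonpos (by linarith) hle (by linarith)
      _ = L ^ (-ρ) := by
          rw [← Real.rpow_mul hL0.le, hθ]
          congr 1; field_simp
  · have hexp : (q : ℝ) ^ (13 * q ^ 2) ≤ Real.exp (L / 2) := by
      rw [← Real.exp_log (pow_pos hq0 _), Real.exp_le_exp, Real.log_pow]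
      calc ((13 * q ^ 2 : ℕ) : ℝ) * Real.log q ≤ ((13 * q ^ 2 : ℕ) : ℝ) * ((q : ℝ) ^ e / e) := by
            gcongr
            exact Real.log_le_rpow_div hq0.le he0
        _ = 13 / e * (q : ℝ) ^ (2 + e) := by
            rw [Real.rpow_add hq0, Real.rpow_two]; push_cast; ring
        _ ≤ 13 / e * (2 * L ^ θ) ^ (2 + e) := by gcongr
        _ = K * L ^ β := by
            rw [Real.mul_rpow (by norm_num) (by linarith), ← Real.rpow_mul hL0.le, hθe, hK]
            ring
        _ = K * (L ^ (-(1 - β)) * L) := by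
            congr 1
            nth_rewrite 3 [← Real.rpow_one L]
            rw [← Real.rpow_add hL0]
            congr 1; ring
        _ ≤ K * (1 / (2 * K) * L) := by gcongr
        _ = L / 2 := by field_simp
    calc (q : ℝ) ^ (13 * q ^ 2) * Real.exp (-L) ≤ Real.exp (L / 2) * Real.exp (-L) := by gcongr
      _ = Real.exp (-(1 / 2) * L) := by rw [← Real.exp_add]; congr 1; ring
      _ ≤ _ := h3

/-! ### From the Radon transform to truncated integrals and data norms -/

section Radon

variable {u : EuclideanSpace ℝ (Fin 2) → ℂ}

/-- On such a line the support forces `x² ≤ |x|/4 + 1/16`, hence `|x| ≤ 1/2`, which lies inside the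
window of radius `1` about `x₀`. -/
theorem radon_eq_primRadon (hu0 : ∀ x t : ℝ, t < x ^ 2 → u !₂[x, t] = 0) {x₀ ξ η : ℝ}
    (hx₀ : |x₀| ≤ 1 / 4) (hξ : |ξ| ≤ 1 / 4) (hη : η ≤ 1 / 16) :
    radon u ξ η = primRadon (fun x y => u !₂[x, y]) (x₀ - 1) (x₀ + 1) 0 ξ η := by
  refine (intervalIntegral.integral_eq_integral_of_support_subset fun x hx => ?_).symm
  have hx' : x ^ 2 ≤ ξ * x + η := not_lt.1 fun h => hx (hu0 x _ h)
  have h1 : ξ * x ≤ 1 / 4 * |x| :=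
    (le_abs_self _).trans (by rw [abs_mul]; gcongr)
  have h2 : |x| ≤ 1 / 2 := by
    by_contra! h
    nlinarith [sq_abs x]
  obtain ⟨h3, h4⟩ := abs_le.1 h2
  obtain ⟨h5, h6⟩ := abs_le.1 hx₀
  exact ⟨by linarith, by linarith⟩

/-- For lines near a given one the integrand vanishes outside a common bounded interval. Continuity
is needed because `ControlsData` speaks only of continuous data. -/
theorem continuous_radon (hu : Continuous u) (hu0 : ∀ x t : ℝ, t < x ^ 2 → u !₂[x, t] = 0) :
    Continuous fun p : ℝ × ℝ => radon u p.1 p.2 := by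
  have hU : Continuous fun p : ℝ × ℝ => u !₂[p.1, p.2] := hu.comp (by fun_prop)
  refine continuous_iff_continuousAt.2 fun p₀ => ?_
  set A := |p₀.1| + |p₀.2| + 1 with hA
  have hA1 : 1 ≤ A := by have := abs_nonneg p₀.1; have := abs_nonneg p₀.2; linarith
  have hev : ∀ᶠ p : ℝ × ℝ in nhds p₀,
      primRadon (fun x y => u !₂[x, y]) (-(A + 2)) (A + 2) 0 p.1 p.2 = radon u p.1 p.2 := by
    have e1 : ∀ᶠ p : ℝ × ℝ in nhds p₀, |p.1| < A :=
      (continuous_fst.abs.continuousAt).eventually_lt_const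
        (by have := abs_nonneg p₀.2; linarith)
    have e2 : ∀ᶠ p : ℝ × ℝ in nhds p₀, |p.2| < A :=
      (continuous_snd.abs.continuousAt).eventually_lt_const
        (by have := abs_nonneg p₀.1; linarith)
    filter_upwards [e1, e2] with p h1 h2
    refine intervalIntegral.integral_eq_integral_of_support_subset fun x hx => ?_
    have hx' : x ^ 2 ≤ p.1 * x + p.2 := not_lt.1 fun h => hx (hu0 x _ h)
    have h3 : p.1 * x ≤ A * |x| :=
      (le_abs_self _).trans (by rw [abs_mul]; gcongr)
    have h4 : |x| ≤ A + 1 := by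
      by_contra! h
      nlinarith [sq_abs x, le_abs_self p.2]
    obtain ⟨h5, h6⟩ := abs_le.1 h4
    exact ⟨by linarith, by linarith⟩
  exact ((continuous_primRadon hU _ _ 0).continuousAt).congr hev

theorem ofReal_integral_norm_le_lineNorm {g : ℝ → ℝ → ℂ}
    (hg : Continuous fun p : ℝ × ℝ => g p.1 p.2) {ε s : ℝ} (hs : 0 ≤ s) (hsε : s ≤ ε) (η : ℝ) :
    ENNReal.ofReal (∫ ξ in (-s)..s, ‖g ξ η‖) ≤ lineNorm ε η g := by
  have hgη : Continuous fun ξ => g ξ η := hg.comp (by fun_prop : Continuous fun ξ : ℝ => (ξ, η))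
  rw [intervalIntegral.integral_of_le (by linarith), ofReal_integral_norm_eq_lintegral_enorm
    (hgη.integrableOn_Ioc)]
  exact lintegral_mono_set fun ξ hξ => ⟨by linarith [hξ.1], by linarith [hξ.2]⟩

theorem ofReal_integral_integral_norm_le_rectNorm {g : ℝ → ℝ → ℂ}
    (hg : Continuous fun p : ℝ × ℝ => g p.1 p.2) {ε s δ : ℝ} (hs : 0 ≤ s) (hsε : s ≤ ε)
    (hδ : 0 ≤ δ) :
    ENNReal.ofReal (∫ ξ in (-s)..s, ∫ τ in (-δ)..δ, ‖g ξ τ‖) ≤ rectNorm ε δ g := by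
  have hint : IntegrableOn (fun p : ℝ × ℝ => g p.1 p.2) (Ioc (-s) s ×ˢ Ioo (-δ) δ) :=
    (hg.continuousOn.integrableOn_compact (isCompact_Icc.prod isCompact_Icc)).mono_set
      (prod_mono Ioc_subset_Icc_self Ioo_subset_Icc_self)
  have h : ∫ ξ in (-s)..s, ∫ τ in (-δ)..δ, ‖g ξ τ‖
      = ∫ p in Ioc (-s) s ×ˢ Ioo (-δ) δ, ‖g p.1 p.2‖ := by
    rw [Measure.volume_eq_prod, setIntegral_prod (fun p : ℝ × ℝ => ‖g p.1 p.2‖) hint.norm,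
      intervalIntegral.integral_of_le (by linarith)]
    simp_rw [intervalIntegral.integral_of_le (show -δ ≤ δ by linarith),
      integral_Ioc_eq_integral_Ioo]
  rw [h, ofReal_integral_norm_eq_lintegral_enorm hint]
  refine lintegral_mono_set fun p hp => ⟨abs_le.2 ⟨?_, ?_⟩, abs_lt.2 hp.2⟩
  · linarith [hp.1.1]
  · linarith [hp.1.2]

end Radon

/-! ### Stability estimate -/

theorem holderWith_of_eHolderNorm_le {X Y : Type*} [MetricSpace X] [EMetricSpace Y] {f : X → Y}
    {C r : ℝ≥0} (h : eHolderNorm r f ≤ C) : HolderWith C r f := by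
  have hm : MemHolder r f := eHolderNorm_lt_top.1 (h.trans_lt ENNReal.coe_lt_top)
  intro x y
  refine (hm.holderWith x y).trans ?_
  rw [hm.coe_nnHolderNorm_eq_eHolderNorm]
  gcongr

/-- Stability of the local Radon transform at the height `δ`, at a fixed degree of approximation. -/
theorem norm_le_of_dataNorm_le {N : ℝ → ℝ → (ℝ → ℝ → ℂ) → ℝ≥0∞} {κ : ℝ≥0} {ε δ : ℝ}
    (hN : ∀ g : ℝ → ℝ → ℂ, Continuous (fun p : ℝ × ℝ => g p.1 p.2) →
      max (rectNorm ε δ g) (lineNorm ε δ g) ≤ κ * N ε δ g)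
    (hδ0 : 0 < δ) (hδ : δ ≤ 1 / 16) {α C₀ : ℝ≥0} (hα0 : 0 < α) (hα : α ≤ 1)
    {u : EuclideanSpace ℝ (Fin 2) → ℂ} (hu : eHolderNorm α u ≤ C₀)
    (hsupp : ∃ c : ℝ, 1 < c ∧ tsupport u ⊆ {p | c * p 0 ^ 2 ≤ p 1})
    (hfin : N ε δ (radon u) ≠ ∞) {q : ℕ} (hq : 4 ≤ q) (hqε : (q : ℝ)⁻¹ ≤ ε)
    (hqδ : (q : ℝ)⁻¹ ^ 2 < 4 * δ) (x : ℝ) :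
    ‖u !₂[x, δ]‖ ≤ 4 * C₀ * (q : ℝ) ^ (-(α : ℝ))
      + (q : ℝ) ^ (13 * q ^ 2) * (κ * (N ε δ (radon u)).toReal) := by
  obtain ⟨c, hc, hsupp⟩ := hsupp
  have hhol := holderWith_of_eHolderNorm_le hu
  have hcont : Continuous u := hhol.continuous hα0
  have hu0 : ∀ x t : ℝ, t < x ^ 2 → u !₂[x, t] = 0 := by
    intro x t ht
    refine image_eq_zero_of_notMem_tsupport fun hmem => ?_
    have : c * x ^ 2 ≤ t := by simpa using hsupp hmem
    nlinarith [sq_nonneg x]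
  -- For `|x| > 1/4` the point `(x, δ)` lies below the parabola, as `δ ≤ 1/16`.
  rcases lt_or_ge (1 / 4) |x| with hx | hx
  · rw [hu0 x δ (by nlinarith [sq_abs x]), norm_zero]
    positivity
  have hU : Continuous fun p : ℝ × ℝ => u !₂[p.1, p.2] := hcont.comp (by fun_prop)
  have hH : ∀ x y x' y' : ℝ, ‖u !₂[x, y] - u !₂[x', y']‖
      ≤ C₀ * √((x - x') ^ 2 + (y - y') ^ 2) ^ (α : ℝ) := by
    intro x y x' y'
    have h := hhol.dist_le !₂[x, y] !₂[x', y']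
    rw [dist_eq_norm, EuclideanSpace.dist_eq] at h
    simpa [Fin.sum_univ_two, Real.dist_eq, sq_abs] using h
  have hq4 : (4 : ℝ) ≤ q := by exact_mod_cast hq
  have hqi : (q : ℝ)⁻¹ ≤ 1 / 4 := by
    rw [inv_le_comm₀ (by linarith) (by norm_num)]; linarith
  have hqi0 : (0 : ℝ) ≤ (q : ℝ)⁻¹ := by positivity
  have hRc := continuous_radon hcont hu0
  have hdata := hN (radon u) hRc
  have hfin' : (κ : ℝ≥0∞) * N ε δ (radon u) ≠ ∞ := ENNReal.mul_ne_top ENNReal.coe_ne_top hfin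
  have hMeq : (κ : ℝ) * (N ε δ (radon u)).toReal = ((κ : ℝ≥0∞) * N ε δ (radon u)).toReal := by
    simp
  have hξle : ∀ ξ ∈ uIcc (-(q : ℝ)⁻¹) (q : ℝ)⁻¹, |ξ| ≤ 1 / 4 := by
    intro ξ hξ
    rw [uIcc_of_le (by linarith)] at hξ
    exact (abs_le.2 hξ).trans hqi
  refine norm_le_of_primRadon_le (U := fun x y => u !₂[x, y]) hU hu0 C₀.coe_nonneg α.coe_nonneg
    ?_ hH hx (by linarith) hq hqδ ?_ ?_
  · have : (α : ℝ) ≤ 1 := by exact_mod_cast hα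
    linarith
  · rw [intervalIntegral.integral_congr (g := fun ξ => ‖radon u ξ δ‖) fun ξ hξ => by
      simp only [radon_eq_primRadon hu0 hx (hξle ξ hξ) hδ], hMeq,
      ← ENNReal.ofReal_le_iff_le_toReal hfin']
    exact (ofReal_integral_norm_le_lineNorm hRc hqi0 hqε δ).trans ((le_max_right _ _).trans hdata)
  · rw [intervalIntegral.integral_congr (g := fun ξ => ∫ τ in (-δ)..δ, ‖radon u ξ τ‖) fun ξ hξ =>
      intervalIntegral.integral_congr fun τ hτ => by
        rw [uIcc_of_le (by linarith)] at hτ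
        simp only [radon_eq_primRadon hu0 hx (hξle ξ hξ) (hτ.2.trans hδ)], hMeq,
      ← ENNReal.ofReal_le_iff_le_toReal hfin']
    exact (ofReal_integral_integral_norm_le_rectNorm hRc hqi0 hqε hδ0.le).trans
      ((le_max_left _ _).trans hdata)

theorem mainTheorem4
    (N : ℝ → ℝ → (ℝ → ℝ → ℂ) → ℝ≥0∞) (hN : ControlsData N)
    (ε : ℝ) (hε : 0 < ε) (hε1 : ε < 1) :
    ∃ δ₀ : ℝ, 0 < δ₀ ∧ δ₀ < 1 ∧ ∀ δ : ℝ, 0 < δ → δ ≤ δ₀ →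
      ∀ (α : ℝ≥0) (ρ : ℝ) (C₀ : ℝ≥0),
        1 / 2 < (α : ℝ) → α ≤ 1 → 0 < ρ → ρ < (α : ℝ) - 1 / 2 →
        ∃ C h₀ : ℝ, 0 < C ∧ 0 < h₀ ∧ h₀ < 1 ∧
          ∀ u : EuclideanSpace ℝ (Fin 2) → ℂ,
            eHolderNorm α u ≤ C₀ →
            (∃ c : ℝ, 1 < c ∧ tsupport u ⊆ {p | c * p 0 ^ 2 ≤ p 1}) →
            N ε δ (radon u) ≤ ENNReal.ofReal h₀ →
              (N ε δ (radon u) = 0 → ∀ x : ℝ, u !₂[x, δ] = 0) ∧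
              (0 < N ε δ (radon u) → ∀ x : ℝ,
                ‖u !₂[x, δ]‖ ≤ C / Real.log (1 / (N ε δ (radon u)).toReal) ^ ρ) := by
  obtain ⟨κ, hκ⟩ := hN
  refine ⟨1 / 16, by norm_num, by norm_num, fun δ hδ0 hδ α ρ C₀ hα2 hα1 hρ hρα => ?_⟩
  have hN := hκ ε δ hε hε1 hδ0 (by linarith)
  have hα0 : 0 < α := by
    have : (0 : ℝ) < α := by linarith
    exact_mod_cast this
  obtain ⟨q₀, hq₀⟩ : ∃ q₀ : ℕ, ∀ q ≥ q₀,
      4 ≤ q ∧ (q : ℝ)⁻¹ ≤ ε ∧ (q : ℝ)⁻¹ ^ 2 < 4 * δ := by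
    have h := tendsto_inv_atTop_nhds_zero_nat (𝕜 := ℝ)
    have h2 := h.pow 2
    rw [zero_pow two_ne_zero] at h2
    exact Filter.eventually_atTop.1 ((Filter.eventually_ge_atTop 4).and
      ((h.eventually_le_const hε).and (h2.eventually_lt_const (by linarith))))
  obtain ⟨L₀, hL₀⟩ := Filter.eventually_atTop.1
    (eventually_exists_degree (α := α) (by exact_mod_cast hα1) hρ hρα q₀)
  set L₁ := max L₀ 1 with hL₁
  -- `L` is kept free: it is `log (1 / ‖R[u]‖)` for nonzero data and tends to infinity for zero
  -- data.
  have key : ∀ u : EuclideanSpace ℝ (Fin 2) → ℂ, eHolderNorm α u ≤ C₀ →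
      (∃ c : ℝ, 1 < c ∧ tsupport u ⊆ {p | c * p 0 ^ 2 ≤ p 1}) → N ε δ (radon u) ≠ ∞ →
      ∀ L ≥ L₁, (N ε δ (radon u)).toReal ≤ Real.exp (-L) → ∀ x : ℝ,
        ‖u !₂[x, δ]‖ ≤ (4 * C₀ + κ + 1) * L ^ (-ρ) := by
    intro u hu hsupp hfin L hL hNL x
    obtain ⟨q, hq, h1, h2⟩ := hL₀ L ((le_max_left _ _).trans hL)
    obtain ⟨hq4, hqε, hqδ⟩ := hq₀ q hq
    have hLpos : 0 < L := lt_of_lt_of_le zero_lt_one ((le_max_right _ _).trans hL)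
    calc ‖u !₂[x, δ]‖ ≤ 4 * C₀ * (q : ℝ) ^ (-(α : ℝ))
          + (q : ℝ) ^ (13 * q ^ 2) * (κ * (N ε δ (radon u)).toReal) :=
          norm_le_of_dataNorm_le hN hδ0 hδ hα0 hα1 hu hsupp hfin hq4 hqε hqδ x
      _ ≤ 4 * C₀ * L ^ (-ρ) + (q : ℝ) ^ (13 * q ^ 2) * (κ * Real.exp (-L)) := by gcongr
      _ = 4 * C₀ * L ^ (-ρ) + κ * ((q : ℝ) ^ (13 * q ^ 2) * Real.exp (-L)) := by ring
      _ ≤ 4 * C₀ * L ^ (-ρ) + κ * L ^ (-ρ) := by gcongr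
      _ ≤ (4 * C₀ + κ + 1) * L ^ (-ρ) := by
          have : 0 ≤ L ^ (-ρ) := by positivity
          linarith
  have hL₁pos : 0 < L₁ := lt_of_lt_of_le zero_lt_one (le_max_right _ _)
  refine ⟨4 * C₀ + κ + 1, Real.exp (-L₁), by positivity, Real.exp_pos _, by simpa using hL₁pos,
    fun u hu hsupp hNu => ?_⟩
  have hfin : N ε δ (radon u) ≠ ∞ := ne_top_of_le_ne_top ENNReal.ofReal_ne_top hNu
  refine ⟨fun hzero x => ?_, fun hpos x => ?_⟩
  · have hlim := (tendsto_rpow_neg_atTop hρ).const_mul (4 * (C₀ : ℝ) + κ + 1)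
    rw [mul_zero] at hlim
    have : ‖u !₂[x, δ]‖ ≤ 0 := by
      refine ge_of_tendsto hlim ?_
      filter_upwards [Filter.eventually_ge_atTop L₁] with L hL
      exact key u hu hsupp hfin L hL (by rw [hzero]; simpa using Real.exp_nonneg _) x
    simpa using this
  · have hh : 0 < (N ε δ (radon u)).toReal := ENNReal.toReal_pos hpos.ne' hfin
    have hle : (N ε δ (radon u)).toReal ≤ Real.exp (-L₁) :=
      ENNReal.toReal_le_of_le_ofReal (Real.exp_nonneg _) hNu
    have hL : L₁ ≤ Real.log (1 / (N ε δ (radon u)).toReal) := by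
      rw [one_div, Real.log_inv, le_neg, ← Real.log_exp (-L₁)]
      exact Real.log_le_log hh hle
    have h := key u hu hsupp hfin _ hL (by rw [one_div, Real.log_inv, neg_neg, Real.exp_log hh]) x
    rwa [Real.rpow_neg (hL₁pos.le.trans hL), ← div_eq_mul_inv] at h
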